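/- Let $G(2,\mathbb R^3)$ be the set of $2$-dimensional linear subspaces of $\mathbb R^3$, with the metric $d(V,W)=\|\Pi_V-\Pi_W\|$ (operator norm), where $\Pi_W:\mathbb R^3\to W$ is the orthogonal projection onto $W$. Let $\dim$ denote Hausdorff dimension. For $A\subset\mathbb R^3$ and $s>0$ put \[ E_s(A)=\{W\in G(2,\mathbb R^3):\dim(\Pi_W(A))<s\}, \] and for $0<a\le 3$ and $0<s<\min\{2,a\}$ put \[ T(a,s)=\sup\{\dim(E_s(A)) : A\subset\mathbb R^3,\ \dim(A)=a\}. \] Then the following lower bounds hold for all such $a$ and $s$. \begin{enumerate} \item If $a\le 1$, then $T(a,s)\ge\max\{0,2s-a\}$. \item If $1<a\le 2$, then \[ T(a,s)\ge\begin{cases} 0 & s\le \frac a2,\\ 2s-a & \frac a2<s\le 1,\\ 1 & 1<s\le\frac{a+1}2,\\ 2s-a & \frac{a+1}2<s<a.\end{cases} \] \item If $2<a\le 3$, then \[ T(a,s)\ge\begin{cases} 0 & s\le a-1,\\ 1 & a-1<s\le\frac{a+1}2,\\ 2s-a & \frac{a+1}2<s<2.\end{cases} \] \end{enumerate} -/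

import Mathlib

open scoped ENNReal

/-- The Grassmannian `G(k, ℝⁿ)`: the set of `k`-dimensional linear subspaces of Euclidean
`n`-space. -/
def Grassmannian (k n : ℕ) : Type :=
  {W : Submodule ℝ (EuclideanSpace ℝ (Fin n)) // Module.finrank ℝ W = k}

/-- The orthogonal projection, as a continuous linear endomorphism of `ℝⁿ`,
onto `W`. -/
noncomputable def Grassmannian.proj {k n : ℕ} (W : Grassmannian k n) :
    EuclideanSpace ℝ (Fin n) →L[ℝ] EuclideanSpace ℝ (Fin n) :=
  W.1.starProjection

theorem Grassmannian.proj_injective {k n : ℕ} :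
    Function.Injective (Grassmannian.proj : Grassmannian k n → _) := fun _ _ h =>
  Subtype.ext (Submodule.starProjection_inj.mp h)

/-- The usual metric on the Grassmannian, `dist V W = ‖Π_V - Π_W‖` in operator norm. -/
noncomputable instance Grassmannian.instMetricSpace {k n : ℕ} : MetricSpace (Grassmannian k n) :=
  MetricSpace.induced Grassmannian.proj Grassmannian.proj_injective inferInstance

/-- The exceptional set `E_s(A) = {W ∈ G(k, ℝⁿ) : dim Π_W(A) < s}`, where `Π_W : ℝⁿ → W` is the
orthogonal projection and `dim` is Hausdorff dimension. -/
noncomputable def exceptionalSet {n : ℕ} (k : ℕ) (s : ℝ) (A : Set (EuclideanSpace ℝ (Fin n))) :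
    Set (Grassmannian k n) :=
  {W | dimH (W.1.orthogonalProjectionOnto '' A) < ENNReal.ofReal s}

/-- `T(a, s) = sup {dim E_s(A) : A ⊆ ℝⁿ, dim A = a}` for projections to `k`-planes in `ℝⁿ`. -/
noncomputable def supExceptionalDim (k n : ℕ) (a s : ℝ) : ℝ≥0∞ :=
  ⨆ (A : Set (EuclideanSpace ℝ (Fin n))) (_ : dimH A = ENNReal.ofReal a),
    dimH (exceptionalSet k s A)

/-! The extremal examples are products of digit sets. For `α ∈ [0, 1]` the set `digitSet α` is made
of binary expansions vanishing on the blocks `[⌊α j!⌋, j!)`. At scale `2 ^ (-j!)` it clusters near a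
grid of mesh `2 ^ (-⌊α j!⌋)`, so its dimension is at most `α`. Since `(j - 1)!` is negligible
against `j!`, the free positions have lower density at least `α`, so a coin-tossing measure is
Frostman for every exponent below `α`. All these sets are efficiently covered at the same scales, so
dimensions of products add (`dimH_digitSet_prod₃`).

Let `A` be the product of the digit sets of `α`, `β`, `γ`. Projecting along `(1, u, z)` sends `A`
into a Lipschitz image of the product of the shears `{y - u x}` and `{w - z x}`. If `u ∈ digitSet
η`, then at scale `2 ^ (-j!)` the product `u x` is near a grid of mesh about `2 ^ (-(η + α) j!)`, so
the first shear has dimension at most `max β (η + α)`, and trivially at most `1`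
(`factorialCovered_shearSet`). The second shear is treated in the same way with `z ∈ digitSet ζ`.

The directions form a family of dimension at least `η + ζ`, and passing to planes does not lower it
(`le_dimH_image_slopePlane`). Hence `T(a, s) ≥ η + ζ` whenever `α + β + γ = a` and the bounds for
the two shears add up to less than `s` (`le_supExceptionalDim_of_digitSet`). Each case of the
theorem is a choice of exponents. -/

open MeasureTheory Metric Set Filter Topology
open scoped NNReal Nat

/-! ### Frostman measures and lower bounds for dimension -/

/-- `A` carries a probability measure satisfying a Frostman condition with exponent `t`. -/
def HasFrostmanMeasure {X : Type*} [PseudoMetricSpace X] [MeasurableSpace X] (A : Set X) (t : ℝ) :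
    Prop :=
  ∃ μ : Measure X, IsProbabilityMeasure μ ∧ μ A ≠ 0 ∧ ∃ C : ℝ≥0,
    ∀ (x : X) (r : ℝ), 0 < r → μ (closedBall x r) ≤ C * ENNReal.ofReal (r ^ t)

theorem HasFrostmanMeasure.prod {X Y : Type*} [PseudoMetricSpace X] [MeasurableSpace X]
    [PseudoMetricSpace Y] [MeasurableSpace Y] {A : Set X} {B : Set Y} {t u : ℝ}
    (hA : HasFrostmanMeasure A t) (hB : HasFrostmanMeasure B u) :
    HasFrostmanMeasure (A ×ˢ B) (t + u) := by
  obtain ⟨μ, hμ, hμA, C, hC⟩ := hA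
  obtain ⟨ν, hν, hνB, D, hD⟩ := hB
  refine ⟨μ.prod ν, inferInstance, ?_, C * D, fun x r hr => ?_⟩
  · rw [Measure.prod_prod]
    exact mul_ne_zero hμA hνB
  · rw [← closedBall_prod_same, Measure.prod_prod, Real.rpow_add hr,
      ENNReal.ofReal_mul (Real.rpow_nonneg hr.le _), ENNReal.coe_mul, mul_mul_mul_comm]
    exact mul_le_mul' (hC _ _ hr) (hD _ _ hr)

/-- Mass distribution principle: a fixed positive multiple of `μ` lies below the `t`-dimensional
Hausdorff measure, which is therefore nonzero on `A`. -/
theorem HasFrostmanMeasure.le_dimH {X : Type*} [MetricSpace X] [MeasurableSpace X] [BorelSpace X]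
    {A : Set X} {t : ℝ} (hA : HasFrostmanMeasure A t) : ENNReal.ofReal t ≤ dimH A := by
  obtain ⟨μ, hμ, hμA, C, hC⟩ := hA
  rcases le_or_gt t 0 with ht | ht
  · simp [ENNReal.ofReal_eq_zero.2 ht]
  -- A nonempty `S` lies in a ball centred at one of its points with radius its diameter. The
  -- constant is `C + 1` rather than `C` so that it can be inverted.
  have key : ∀ S : Set X, ediam S ≤ 1 → μ S ≤ (C + 1 : ℝ≥0) * ediam S ^ t := by
    intro S hS
    rcases S.eq_empty_or_nonempty with rfl | ⟨x, hx⟩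
    · simp
    have hfin : ediam S ≠ ∞ := ne_top_of_le_ne_top ENNReal.one_ne_top hS
    have hsub : ∀ r : ℝ, (ediam S).toReal ≤ r → S ⊆ closedBall x r := fun r hr y hy => by
      rw [mem_closedBall, dist_edist]
      exact (ENNReal.toReal_mono hfin (edist_le_ediam_of_mem hy hx)).trans hr
    rcases eq_or_ne (ediam S) 0 with h0 | h0
    -- In diameter zero no single radius suffices; letting `r` tend to `0` gives measure zero, as `t
    -- > 0`.
    · have hlim : Tendsto (fun r : ℝ => (C : ℝ≥0∞) * ENNReal.ofReal (r ^ t)) (𝓝[>] 0) (𝓝 0) := by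
        have h1 : Tendsto (fun r : ℝ => r ^ t) (𝓝 0) (𝓝 ((0 : ℝ) ^ t)) :=
          (Real.continuousAt_rpow_const 0 t (Or.inr ht.le)).tendsto
        rw [Real.zero_rpow ht.ne'] at h1
        have h2 := ENNReal.Tendsto.const_mul (a := (C : ℝ≥0∞)) (ENNReal.tendsto_ofReal h1)
          (Or.inr ENNReal.coe_ne_top)
        simp only [ENNReal.ofReal_zero, mul_zero] at h2
        exact h2.mono_left nhdsWithin_le_nhds
      have : μ S ≤ 0 := ge_of_tendsto hlim <| by
        filter_upwards [self_mem_nhdsWithin] with r hr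
        exact (measure_mono (hsub r (by simpa [h0] using (mem_Ioi.1 hr).le))).trans (hC x r hr)
      exact this.trans zero_le
    · have hpos : 0 < (ediam S).toReal := ENNReal.toReal_pos h0 hfin
      refine (measure_mono (hsub _ le_rfl)).trans ((hC x _ hpos).trans ?_)
      rw [← ENNReal.ofReal_rpow_of_pos hpos, ENNReal.ofReal_toReal hfin]
      gcongr
      simp
  have hle : (((C + 1 : ℝ≥0) : ℝ≥0∞)⁻¹ • μ) ≤ Measure.hausdorffMeasure t := by
    refine Measure.le_hausdorffMeasure t _ 1 one_pos fun S hS => ?_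
    rw [Measure.smul_apply, smul_eq_mul]
    refine (mul_le_mul_right (key S hS) _).trans ?_
    rw [← mul_assoc, ENNReal.inv_mul_cancel (by simp) ENNReal.coe_ne_top, one_mul]
  have hne : Measure.hausdorffMeasure (Real.toNNReal t : ℝ) A ≠ 0 := by
    rw [Real.coe_toNNReal _ ht.le]
    refine fun h => ?_
    have := (hle A).trans h.le
    rw [Measure.smul_apply, smul_eq_mul, nonpos_iff_eq_zero, mul_eq_zero] at this
    rcases this with h | h
    · simp at h
    · exact hμA h
  exact le_dimH_of_hausdorffMeasure_ne_zero hne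

/-! ### Coverings at factorial scales and upper bounds for dimension -/

/-- At each scale `2 ^ (-j!)`, the set `S` is covered by `O(2 ^ (κ j!))` balls. -/
def FactorialCovered {X : Type*} [PseudoMetricSpace X] (S : Set X) (κ : ℝ) : Prop :=
  ∃ C : ℝ, 0 < C ∧ ∀ j : ℕ, ∃ c : Finset X, (c.card : ℝ) ≤ C * 2 ^ (κ * (j ! : ℝ)) ∧
    S ⊆ ⋃ x ∈ c, closedBall x (C * (1 / 2) ^ j !)

/-- The exponents add because both factors are covered at the same prescribed scales; upper bounds
on Hausdorff dimension alone would not add. -/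
theorem FactorialCovered.prod {X Y : Type*} [PseudoMetricSpace X] [PseudoMetricSpace Y]
    {A : Set X} {B : Set Y} {κ l : ℝ} (hA : FactorialCovered A κ) (hB : FactorialCovered B l) :
    FactorialCovered (A ×ˢ B) (κ + l) := by
  obtain ⟨C, hC0, hC⟩ := hA
  obtain ⟨D, hD0, hD⟩ := hB
  refine ⟨max (C * D) (max C D), by positivity, fun j => ?_⟩
  obtain ⟨c, hc, hAc⟩ := hC j
  obtain ⟨d, hd, hBd⟩ := hD j
  refine ⟨c ×ˢ d, ?_, ?_⟩
  · rw [Finset.card_product, Nat.cast_mul, add_mul, Real.rpow_add two_pos]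
    calc (c.card : ℝ) * d.card ≤ (C * 2 ^ (κ * (j ! : ℝ))) * (D * 2 ^ (l * (j ! : ℝ))) := by gcongr
      _ = (C * D) * (2 ^ (κ * (j ! : ℝ)) * 2 ^ (l * (j ! : ℝ))) := by ring
      _ ≤ _ := by gcongr; exact le_max_left _ _
  · rintro ⟨x, y⟩ ⟨hx, hy⟩
    obtain ⟨p, hp, hxp⟩ := mem_iUnion₂.1 (hAc hx)
    obtain ⟨q, hq, hyq⟩ := mem_iUnion₂.1 (hBd hy)
    refine mem_iUnion₂.2 ⟨(p, q), Finset.mem_product.2 ⟨hp, hq⟩, ?_⟩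
    rw [← closedBall_prod_same]
    refine ⟨closedBall_subset_closedBall ?_ hxp, closedBall_subset_closedBall ?_ hyq⟩
    · gcongr
      exact (le_max_left _ _).trans (le_max_right _ _)
    · gcongr
      exact (le_max_right _ _).trans (le_max_right _ _)

theorem FactorialCovered.mono {X : Type*} [PseudoMetricSpace X] {A B : Set X} {κ : ℝ}
    (hB : FactorialCovered B κ) (h : A ⊆ B) : FactorialCovered A κ := by
  obtain ⟨C, hC0, hC⟩ := hB
  refine ⟨C, hC0, fun j => ?_⟩
  obtain ⟨c, hc, hBc⟩ := hC j
  exact ⟨c, hc, h.trans hBc⟩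

theorem tendsto_half_pow_factorial : Tendsto (fun j : ℕ => ((1 / 2 : ℝ)) ^ j !) atTop (𝓝 0) :=
  (tendsto_pow_atTop_nhds_zero_of_lt_one (by norm_num) (by norm_num)).comp
    (tendsto_atTop_mono Nat.self_le_factorial tendsto_id)

/-- Covers along one sequence of scales tending to zero suffice: the sums of `κ`-th powers of
diameters stay bounded by `C * (2 * C) ^ κ`, so the `κ`-dimensional Hausdorff measure is finite. -/
theorem FactorialCovered.dimH_le {X : Type*} [MetricSpace X] {S : Set X} {κ : ℝ} (hκ : 0 ≤ κ)
    (hS : FactorialCovered S κ) : dimH S ≤ ENNReal.ofReal κ := by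
  borelize X
  obtain ⟨C, hC0, hC⟩ := hS
  choose c hc hcov using hC
  have hfin : Measure.hausdorffMeasure κ S ≤ ENNReal.ofReal (C * (2 * C) ^ κ) := by
    refine (Measure.hausdorffMeasure_le_liminf_sum κ S (l := atTop)
      (ι := fun j => (c j : Set X)) (fun j : ℕ => ENNReal.ofReal (2 * (C * (1 / 2) ^ j !)))
      ?_ (fun j x => closedBall (x : X) (C * (1 / 2) ^ j !)) ?_ ?_).trans ?_
    · have := (tendsto_half_pow_factorial.const_mul C).const_mul 2
      simp only [mul_zero] at this
      simpa using ENNReal.tendsto_ofReal this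
    · refine Eventually.of_forall fun j x => ?_
      refine ediam_le fun y hy z hz => ?_
      rw [edist_dist]
      apply ENNReal.ofReal_le_ofReal
      have := dist_triangle_right y z (x : X)
      have h1 := mem_closedBall.1 hy
      have h2 := mem_closedBall.1 hz
      linarith
    · refine Eventually.of_forall fun j y hy => ?_
      obtain ⟨x, hx, hyx⟩ := mem_iUnion₂.1 (hcov j hy)
      exact mem_iUnion.2 ⟨⟨x, hx⟩, hyx⟩
    · refine liminf_le_of_le (by isBoundedDefault) fun b hb => ?_
      obtain ⟨j, hj⟩ := hb.exists
      refine hj.trans ?_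
      have hterm : ∀ x : (c j : Set X), ediam (closedBall (x : X) (C * (1 / 2) ^ j !)) ^ κ ≤
          ENNReal.ofReal ((2 * (C * (1 / 2) ^ j !)) ^ κ) := by
        intro x
        rw [← ENNReal.ofReal_rpow_of_pos (by positivity)]
        refine ENNReal.rpow_le_rpow (ediam_le fun y hy z hz => ?_) hκ
        rw [edist_dist]
        apply ENNReal.ofReal_le_ofReal
        have := dist_triangle_right y z (x : X)
        have h1 := mem_closedBall.1 hy
        have h2 := mem_closedBall.1 hz
        linarith
      refine (Finset.sum_le_sum fun x _ => hterm x).trans ?_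
      rw [Finset.sum_const, nsmul_eq_mul]
      have hcard : (Finset.univ : Finset (c j : Set X)).card = (c j).card := by simp
      rw [hcard, ← ENNReal.ofReal_natCast, ← ENNReal.ofReal_mul (by positivity)]
      apply ENNReal.ofReal_le_ofReal
      calc ((c j).card : ℝ) * (2 * (C * (1 / 2) ^ j !)) ^ κ
          ≤ (C * 2 ^ (κ * (j ! : ℝ))) * (2 * (C * (1 / 2) ^ j !)) ^ κ := by
            gcongr; exact hc j
        _ = C * (2 * C) ^ κ := by
            rw [← mul_assoc 2 C, Real.mul_rpow (by positivity) (by positivity),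
              ← Real.rpow_natCast (1 / 2), ← Real.rpow_mul (by norm_num), one_div,
              Real.inv_rpow (by norm_num), mul_comm (j ! : ℝ) κ]
            field_simp
  have := dimH_le_of_hausdorffMeasure_ne_top (s := S) (d := Real.toNNReal κ) (by
    rw [Real.coe_toNNReal _ hκ]
    exact ne_top_of_le_ne_top ENNReal.ofReal_ne_top hfin)
  exact this

/-- A bounded subset of `ℝ` near a grid of mesh `2 ^ (-⌊κ j!⌋)` at each scale `2 ^ (-j!)`. -/
theorem FactorialCovered.of_grid {S : Set ℝ} {κ B : ℝ} (hκ : 0 ≤ κ) (hB : 0 < B)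
    (hS : ∀ x ∈ S, |x| ≤ B)
    (h : ∀ x ∈ S, ∀ j : ℕ, ∃ k : ℤ, |x - k / 2 ^ ⌊κ * (j ! : ℝ)⌋₊| ≤ B * (1 / 2) ^ j !) :
    FactorialCovered S κ := by
  classical
  refine ⟨4 * B + 3, by positivity, fun j => ?_⟩
  set n := ⌊κ * (j ! : ℝ)⌋₊ with hn
  have hn2 : (2 : ℝ) ^ n ≤ 2 ^ (κ * (j ! : ℝ)) := by
    rw [← Real.rpow_natCast]
    exact Real.rpow_le_rpow_of_exponent_le (by norm_num) (Nat.floor_le (by positivity))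
  have h1 : (1 : ℝ) ≤ 2 ^ n := one_le_pow₀ (by norm_num)
  -- A grid point within `B` of some `x` with `|x| ≤ B` has absolute value at most `2 * B`. The
  -- count `2 * N + 1` is then at most `(4 * B + 3) * 2 ^ n`, whence the constant.
  set N : ℤ := ⌈2 * B * 2 ^ n⌉ with hN
  refine ⟨(Finset.Icc (-N) N).image fun k : ℤ => (k : ℝ) / 2 ^ n, ?_, fun x hx => ?_⟩
  · have hN0 : 0 ≤ N := Int.ceil_nonneg (by positivity)
    have hcard : (((Finset.Icc (-N) N).card : ℤ) : ℝ) = 2 * N + 1 := by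
      rw [Int.card_Icc, Int.toNat_of_nonneg (by omega)]
      push_cast; ring
    have hNlt := Int.ceil_lt_add_one (2 * B * 2 ^ n)
    rw [← hN] at hNlt
    calc ((((Finset.Icc (-N) N).image fun k : ℤ => (k : ℝ) / 2 ^ n).card : ℕ) : ℝ)
        ≤ ((Finset.Icc (-N) N).card : ℝ) := by exact_mod_cast Finset.card_image_le
      _ = 2 * N + 1 := by exact_mod_cast hcard
      _ ≤ (4 * B + 3) * 2 ^ n := by nlinarith
      _ ≤ _ := by gcongr
  · obtain ⟨k, hk⟩ := h x hx j
    refine mem_iUnion₂.2 ⟨(k : ℝ) / 2 ^ n, Finset.mem_image_of_mem _ ?_, ?_⟩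
    · have hp : (1 / 2 : ℝ) ^ j ! ≤ 1 := pow_le_one₀ (by norm_num) (by norm_num)
      have hkB : |(k : ℝ) / 2 ^ n| ≤ 2 * B := by
        have h2 := abs_sub_abs_le_abs_sub ((k : ℝ) / 2 ^ n) x
        rw [abs_sub_comm] at h2
        have := hS x hx
        nlinarith
      rw [abs_div, abs_of_pos (by positivity : (0 : ℝ) < 2 ^ n), div_le_iff₀ (by positivity)] at hkB
      have hkN : |(k : ℝ)| ≤ N := hkB.trans (Int.le_ceil _)
      rw [Finset.mem_Icc, ← abs_le]
      exact_mod_cast hkN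
    · rw [mem_closedBall, Real.dist_eq]
      refine hk.trans ?_
      gcongr
      linarith

theorem FactorialCovered.of_bounded {S : Set ℝ} {B : ℝ} (hB : 1 ≤ B)
    (hS : ∀ x ∈ S, |x| ≤ B) : FactorialCovered S 1 := by
  refine .of_grid zero_le_one (by linarith) hS fun x _ j => ⟨⌊x * 2 ^ j !⌋, ?_⟩
  rw [one_mul, Nat.floor_natCast]
  have h2 : (0 : ℝ) < 2 ^ j ! := by positivity
  have h3 : x - ⌊x * 2 ^ j !⌋ / 2 ^ j ! = Int.fract (x * 2 ^ j !) * (1 / 2) ^ j ! := by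
    rw [Int.fract, one_div, inv_pow]
    field_simp
  rw [h3, abs_of_nonneg (mul_nonneg (Int.fract_nonneg _) (by positivity))]
  gcongr
  exact (Int.fract_lt_one _).le.trans hB

/-! ### Binary expansions with prescribed positions -/

open Classical in
/-- The integer whose binary digits are the first `K` terms of `ω`, those at positions outside `F`
being replaced by zero. -/
noncomputable def binaryPrefix (F : Set ℕ) (ω : ℕ → Bool) : ℕ → ℕ
  | 0 => 0
  | K + 1 => 2 * binaryPrefix F ω K + if K ∈ F ∧ ω K = true then 1 else 0

/-- The real number in `[0, 1]` with binary digits `ω`, those outside `F` replaced by zero. -/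
noncomputable def binaryValue (F : Set ℕ) (ω : ℕ → Bool) : ℝ :=
  ⨆ K, (binaryPrefix F ω K : ℝ) / 2 ^ K

section Binary

variable (F : Set ℕ) (ω : ℕ → Bool)

theorem binaryPrefix_succ_cases (K : ℕ) :
    binaryPrefix F ω (K + 1) = 2 * binaryPrefix F ω K ∨
      binaryPrefix F ω (K + 1) = 2 * binaryPrefix F ω K + 1 := by
  rw [binaryPrefix]
  split_ifs <;> simp

theorem monotone_binaryPrefix_div : Monotone fun K => (binaryPrefix F ω K : ℝ) / 2 ^ K := by
  refine monotone_nat_of_le_succ fun K => ?_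
  rw [div_le_div_iff₀ (by positivity) (by positivity), pow_succ]
  have h : (2 : ℝ) * binaryPrefix F ω K ≤ binaryPrefix F ω (K + 1) := by
    rcases binaryPrefix_succ_cases F ω K with h | h <;> rw [h] <;> push_cast <;> linarith
  have : (0 : ℝ) < 2 ^ K := by positivity
  nlinarith

theorem antitone_binaryPrefix_add_one_div :
    Antitone fun K => ((binaryPrefix F ω K : ℝ) + 1) / 2 ^ K := by
  refine antitone_nat_of_succ_le fun K => ?_
  rw [div_le_div_iff₀ (by positivity) (by positivity), pow_succ]
  have h : (binaryPrefix F ω (K + 1) : ℝ) ≤ 2 * binaryPrefix F ω K + 1 := by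
    rcases binaryPrefix_succ_cases F ω K with h | h <;> rw [h] <;> push_cast <;> linarith
  have : (0 : ℝ) < 2 ^ K := by positivity
  nlinarith

theorem binaryPrefix_div_le_add_one_div (J K : ℕ) :
    (binaryPrefix F ω J : ℝ) / 2 ^ J ≤ ((binaryPrefix F ω K : ℝ) + 1) / 2 ^ K := by
  refine (monotone_binaryPrefix_div F ω (le_max_left J K)).trans (le_trans ?_
    (antitone_binaryPrefix_add_one_div F ω (le_max_right J K)))
  dsimp only
  gcongr
  linarith

theorem binaryValue_le (K : ℕ) :
    binaryValue F ω ≤ ((binaryPrefix F ω K : ℝ) + 1) / 2 ^ K :=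
  ciSup_le fun J => binaryPrefix_div_le_add_one_div F ω J K

theorem le_binaryValue (K : ℕ) : (binaryPrefix F ω K : ℝ) / 2 ^ K ≤ binaryValue F ω :=
  le_ciSup (f := fun K => (binaryPrefix F ω K : ℝ) / 2 ^ K)
    ⟨_, by rintro _ ⟨J, rfl⟩; exact binaryPrefix_div_le_add_one_div F ω J 0⟩ K

theorem binaryValue_nonneg : 0 ≤ binaryValue F ω := by
  simpa [binaryPrefix] using le_binaryValue F ω 0

theorem binaryValue_le_one : binaryValue F ω ≤ 1 := by
  simpa [binaryPrefix] using binaryValue_le F ω 0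

theorem binaryPrefix_div_eq {m n : ℕ} (hmn : m ≤ n) (h : ∀ k, m ≤ k → k < n → k ∉ F) :
    (binaryPrefix F ω n : ℝ) / 2 ^ n = (binaryPrefix F ω m : ℝ) / 2 ^ m := by
  induction n, hmn using Nat.le_induction with
  | base => rfl
  | succ n hmn ih =>
    rw [← ih fun k hk hkn => h k hk (by omega), binaryPrefix,
      if_neg fun hh => h n hmn (by omega) hh.1, pow_succ]
    push_cast
    field_simp
    ring

/-- With no free digit in `[m, n)`, truncation at `m` is already truncation at `n`. -/
theorem abs_binaryValue_sub_le {m n : ℕ} (hmn : m ≤ n) (h : ∀ k, m ≤ k → k < n → k ∉ F) :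
    |binaryValue F ω - (binaryPrefix F ω m : ℝ) / 2 ^ m| ≤ (1 / 2) ^ n := by
  rw [← binaryPrefix_div_eq F ω hmn h, abs_of_nonneg (by linarith [le_binaryValue F ω n])]
  have := binaryValue_le F ω n
  rw [add_div] at this
  rw [one_div, inv_pow, ← one_div]
  linarith

theorem eq_of_binaryPrefix_eq {ω' : ℕ → Bool} {K : ℕ}
    (h : binaryPrefix F ω K = binaryPrefix F ω' K) : ∀ i < K, i ∈ F → ω i = ω' i := by
  induction K with
  | zero => intro i hi; omega
  | succ K ih =>
    rw [binaryPrefix, binaryPrefix] at h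
    have h1 : binaryPrefix F ω K = binaryPrefix F ω' K := by split_ifs at h <;> omega
    intro i hi hiF
    rcases Nat.lt_succ_iff_lt_or_eq.1 hi with hi | rfl
    · exact ih h1 i hi hiF
    · rw [h1] at h
      cases hω : ω i <;> cases hω' : ω' i <;> simp_all

theorem measurable_binaryPrefix (K : ℕ) : Measurable fun ω => binaryPrefix F ω K := by
  induction K with
  | zero => exact measurable_const
  | succ K ih =>
    simp only [binaryPrefix]
    refine (ih.const_mul 2).add (Measurable.ite ?_ measurable_const measurable_const)
    by_cases hK : K ∈ F
    · simp only [hK, true_and]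
      exact measurableSet_eq_fun (measurable_pi_apply K) measurable_const
    · simp [hK]

theorem measurable_binaryValue : Measurable (binaryValue F) :=
  Measurable.iSup fun K =>
    ((measurable_from_top (f := fun n : ℕ => (n : ℝ))).comp
      (measurable_binaryPrefix F K)).div_const _

end Binary

/-! ### The coin-tossing measure on binary expansions -/

/-- The law of a sequence of independent fair coin tosses. -/
noncomputable def coinTossing : Measure (ℕ → Bool) :=
  Measure.infinitePi fun _ => (PMF.uniformOfFintype Bool).toMeasure

instance : IsProbabilityMeasure coinTossing := by
  unfold coinTossing; infer_instance

open Classical in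
/-- The number of elements of `F` below `K`. -/
noncomputable def countBelow (F : Set ℕ) (K : ℕ) : ℕ := ((Finset.range K).filter (· ∈ F)).card

/-- A prescribed prefix determines the coins at all positions of `F` below `K`, and these are
independent. -/
theorem coinTossing_binaryPrefix_eq_le (F : Set ℕ) (K p : ℕ) :
    coinTossing {ω | binaryPrefix F ω K = p} ≤ ENNReal.ofReal ((1 / 2) ^ countBelow F K) := by
  classical
  rcases eq_empty_or_nonempty {ω | binaryPrefix F ω K = p} with h | ⟨ω₀, hω₀⟩
  · simp [h]
  set s : Finset ℕ := (Finset.range K).filter (· ∈ F)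
  have hsub : {ω | binaryPrefix F ω K = p} ⊆ Set.pi s fun i => {ω₀ i} := fun ω hω i hi => by
    have hi' := Finset.mem_filter.1 (Finset.mem_coe.1 hi)
    exact eq_of_binaryPrefix_eq F ω (hω.trans hω₀.symm) i (Finset.mem_range.1 hi'.1) hi'.2
  refine (measure_mono hsub).trans (le_of_eq ?_)
  rw [coinTossing, Measure.infinitePi_pi _ fun i _ => measurableSet_singleton _]
  have : ∀ i, (PMF.uniformOfFintype Bool).toMeasure {ω₀ i} = ENNReal.ofReal (1 / 2) := fun i => by
    rw [PMF.toMeasure_apply_singleton _ _ (measurableSet_singleton _), PMF.uniformOfFintype_apply]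
    simp [ENNReal.ofReal_inv_of_pos]
  simp only [this, Finset.prod_const]
  rw [ENNReal.ofReal_pow (by norm_num)]
  rfl

/-- A ball of radius about `2 ^ (-K)` meets at most four dyadic intervals of that length, each of
mass at most `2 ^ (-countBelow F K) ≤ 2 ^ (C - t K)`. -/
theorem hasFrostmanMeasure_range_binaryValue {F : Set ℕ} {t C : ℝ} (ht : 0 ≤ t)
    (hF : ∀ K : ℕ, t * K - C ≤ countBelow F K) :
    HasFrostmanMeasure (range (binaryValue F)) t := by
  have hC0 : 0 ≤ C := by simpa [countBelow] using hF 0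
  have hprob : IsProbabilityMeasure (coinTossing.map (binaryValue F)) :=
    Measure.isProbabilityMeasure_map (measurable_binaryValue F).aemeasurable
  refine ⟨coinTossing.map (binaryValue F), hprob, fun h => ?_,
    -- The factor `4` counts dyadic intervals, `2 ^ C` is the loss in `hF`, and `2 ^ t` comes from
    -- rounding `r` to a power of `1 / 2`.
    Real.toNNReal (4 * 2 ^ C * 2 ^ t), fun x r hr => ?_⟩
  -- This inequality holds for arbitrary sets, so measurability of the range is not needed.
  · have := Measure.le_map_apply (μ := coinTossing) (measurable_binaryValue F).aemeasurable
      (range (binaryValue F))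
    rw [h, preimage_range] at this
    simp at this
  change _ ≤ ENNReal.ofReal (4 * 2 ^ C * 2 ^ t) * _
  rw [← ENNReal.ofReal_mul (by positivity)]
  have h2C : (1 : ℝ) ≤ 2 ^ C := Real.one_le_rpow (by norm_num) hC0
  have h2t : (1 : ℝ) ≤ 2 ^ t := Real.one_le_rpow (by norm_num) ht
  rcases le_or_gt 1 r with hr1 | hr1
  · refine prob_le_one.trans ?_
    rw [ENNReal.one_le_ofReal]
    have := Real.one_le_rpow hr1 ht
    have h3 : (1 : ℝ) ≤ 2 ^ C * 2 ^ t := one_le_mul_of_one_le_of_one_le h2C h2t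
    have h4 : (1 : ℝ) ≤ 4 * 2 ^ C * 2 ^ t := by linarith
    exact one_le_mul_of_one_le_of_one_le h4 this
  obtain ⟨K, hK1, hK2⟩ := exists_nat_pow_near_of_lt_one hr hr1.le
    (by norm_num : (0 : ℝ) < 1 / 2) (by norm_num)
  rw [Measure.map_apply (measurable_binaryValue F) measurableSet_closedBall]
  have h2K : (0 : ℝ) < 2 ^ K := by positivity
  -- If the value is `v` and the prefix is `p`, then `p ≤ 2 ^ K v ≤ p + 1` and `|2 ^ K v - 2 ^ K x|
  -- ≤ 1`.
  set I : Finset ℤ := Finset.Icc ⌈2 ^ K * x - 2⌉ ⌊2 ^ K * x + 1⌋ with hI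
  have hIcard : (I.card : ℝ) ≤ 4 := by
    have h1 := Int.floor_le (2 ^ K * x + 1)
    have h2 := Int.le_ceil (2 ^ K * x - 2)
    have h3 : ⌊2 ^ K * x + 1⌋ - ⌈2 ^ K * x - 2⌉ ≤ 3 := by
      have : ((⌊2 ^ K * x + 1⌋ - ⌈2 ^ K * x - 2⌉ : ℤ) : ℝ) ≤ (3 : ℤ) := by push_cast; linarith
      exact_mod_cast this
    have h4 : I.card ≤ 4 := by rw [hI, Int.card_Icc]; omega
    exact_mod_cast h4
  have hsub : binaryValue F ⁻¹' closedBall x r ⊆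
      ⋃ p ∈ I, {ω | binaryPrefix F ω K = p.toNat} := fun ω hω => by
    have hω' : |binaryValue F ω - x| ≤ (1 / 2) ^ K := (mem_closedBall.1 hω).trans hK2
    rw [abs_le, one_div, inv_pow] at hω'
    have h1 := le_binaryValue F ω K
    have h2 := binaryValue_le F ω K
    rw [div_le_iff₀ h2K] at h1
    rw [le_div_iff₀ h2K] at h2
    have h3 : ((2 : ℝ) ^ K)⁻¹ * 2 ^ K = 1 := inv_mul_cancel₀ h2K.ne'
    refine mem_iUnion₂.2 ⟨(binaryPrefix F ω K : ℤ), ?_, by simp⟩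
    rw [hI, Finset.mem_Icc, Int.ceil_le, Int.le_floor]
    push_cast
    constructor <;> nlinarith
  calc coinTossing (binaryValue F ⁻¹' closedBall x r)
      ≤ ∑ p ∈ I, coinTossing {ω | binaryPrefix F ω K = p.toNat} :=
        (measure_mono hsub).trans (measure_biUnion_finset_le _ _)
    _ ≤ ∑ _p ∈ I, ENNReal.ofReal ((1 / 2) ^ countBelow F K) :=
        Finset.sum_le_sum fun p _ => coinTossing_binaryPrefix_eq_le F K _
    _ = ENNReal.ofReal (I.card * (1 / 2) ^ countBelow F K) := by
        rw [Finset.sum_const, nsmul_eq_mul, ENNReal.ofReal_mul (by positivity),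
          ENNReal.ofReal_natCast]
    _ ≤ _ := by
        apply ENNReal.ofReal_le_ofReal
        have h1 : ((1 : ℝ) / 2) ^ countBelow F K ≤ 2 ^ C * (1 / 2) ^ (t * K) := by
          rw [← Real.rpow_natCast, one_div, Real.inv_rpow (by norm_num),
            Real.inv_rpow (by norm_num), ← Real.rpow_neg (by norm_num),
            ← Real.rpow_neg (by norm_num), ← Real.rpow_add two_pos]
          exact Real.rpow_le_rpow_of_exponent_le (by norm_num) (by linarith [hF K])
        have h2 : ((1 : ℝ) / 2) ^ (t * K) ≤ 2 ^ t * r ^ t := by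
          rw [← Real.mul_rpow (by norm_num) hr.le, mul_comm t, Real.rpow_mul (by norm_num),
            Real.rpow_natCast]
          refine Real.rpow_le_rpow (by positivity) ?_ ht
          rw [pow_succ] at hK1
          linarith
        calc (I.card : ℝ) * (1 / 2) ^ countBelow F K ≤ 4 * (2 ^ C * (2 ^ t * r ^ t)) := by
              gcongr
              exact h1.trans (by gcongr)
          _ = _ := by ring

/-! ### Digit sets and the dimension of their products -/

/-- The natural numbers outside all the blocks `[⌊α j!⌋, j!)`. -/
def digitPositions (α : ℝ) : Set ℕ := {k | ∀ j : ℕ, ¬(⌊α * (j ! : ℝ)⌋₊ ≤ k ∧ k < j !)}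

/-- The reals in `[0, 1]` having a binary expansion supported on `digitPositions α`, a set of
Hausdorff dimension `α` when `α ∈ [0, 1]`. -/
noncomputable def digitSet (α : ℝ) : Set ℝ := range (binaryValue (digitPositions α))

theorem digitSet_nonneg {α x : ℝ} (hx : x ∈ digitSet α) : 0 ≤ x := by
  obtain ⟨ω, rfl⟩ := hx
  exact binaryValue_nonneg _ _

theorem digitSet_le_one {α x : ℝ} (hx : x ∈ digitSet α) : x ≤ 1 := by
  obtain ⟨ω, rfl⟩ := hx
  exact binaryValue_le_one _ _

theorem digitSet_abs_le_one {α x : ℝ} (hx : x ∈ digitSet α) : |x| ≤ 1 := by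
  rw [abs_of_nonneg (digitSet_nonneg hx)]
  exact digitSet_le_one hx

theorem exists_abs_sub_le_of_mem_digitSet {α x : ℝ} (hα : α ≤ 1) (hx : x ∈ digitSet α) (j : ℕ) :
    ∃ k : ℤ, |x - k / 2 ^ ⌊α * (j ! : ℝ)⌋₊| ≤ (1 / 2) ^ j ! := by
  obtain ⟨ω, rfl⟩ := hx
  refine ⟨binaryPrefix (digitPositions α) ω ⌊α * (j ! : ℝ)⌋₊, ?_⟩
  have hle : ⌊α * (j ! : ℝ)⌋₊ ≤ j ! := by
    refine Nat.floor_le_of_le ?_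
    exact mul_le_of_le_one_left (by positivity) hα
  rw [Int.cast_natCast]
  exact abs_binaryValue_sub_le (digitPositions α) ω hle fun k hk hkj hF => hF j ⟨hk, hkj⟩

/-- For exponent `0` the blocks `[0, j!)` exhaust all positions, leaving no free digit. -/
theorem eq_zero_of_mem_digitSet_zero {x : ℝ} (hx : x ∈ digitSet 0) : x = 0 := by
  obtain ⟨ω, rfl⟩ := hx
  have h : ∀ j : ℕ, |binaryValue (digitPositions 0) ω| ≤ (1 / 2) ^ j ! := fun j => by
    have := abs_binaryValue_sub_le (digitPositions 0) ω (Nat.zero_le (j !))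
      fun k _ hkj hF => hF j ⟨by simp, hkj⟩
    simpa [binaryPrefix] using this
  exact abs_nonpos_iff.1 (ge_of_tendsto' tendsto_half_pow_factorial h)

/-- Of the positions below `K`, the block currently reached removes at most `(1 - α) K + 1`, and all
earlier blocks lie below `(m - 1)!`, which is at most `(α - t) K` except for small `m`. -/
theorem exists_le_countBelow_digitPositions {α t : ℝ} (hα : 0 < α) (hα1 : α ≤ 1) (ht : t < α) :
    ∃ C : ℝ, ∀ K : ℕ, t * K - C ≤ countBelow (digitPositions α) K := by
  classical
  -- For `m > J` this gives `(m - 1)! ≤ (α - t) * (α * m !)`.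
  obtain ⟨J, hJ⟩ := exists_nat_gt (1 / (α * (α - t)))
  have hαt : 0 < α * (α - t) := mul_pos hα (by linarith)
  rw [div_lt_iff₀ hαt] at hJ
  have hmono : Monotone fun n : ℕ => ⌊α * (n ! : ℝ)⌋₊ := fun m n hmn =>
    Nat.floor_mono (by gcongr)
  refine ⟨J ! + 1, fun K => ?_⟩
  have hcompl : (countBelow (digitPositions α) K : ℝ) =
      K - ((Finset.range K).filter (· ∉ digitPositions α)).card := by
    have := Finset.card_filter_add_card_filter_not (s := Finset.range K) (· ∈ digitPositions α)
    rw [Finset.card_range] at this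
    rw [countBelow, eq_sub_iff_add_eq]
    exact_mod_cast this
  rw [hcompl]
  suffices (((Finset.range K).filter (· ∉ digitPositions α)).card : ℝ) ≤
      J ! + 1 + (1 - t) * K by linarith
  have hex : ∃ n : ℕ, K ≤ ⌊α * (n ! : ℝ)⌋₊ := by
    obtain ⟨n, hn⟩ := exists_nat_gt (K / α)
    refine ⟨n, Nat.le_floor ?_⟩
    rw [div_lt_iff₀ hα] at hn
    have : (n : ℝ) ≤ n ! := by exact_mod_cast Nat.self_le_factorial n
    nlinarith
  have ht1 : 0 ≤ (1 - t) * K := mul_nonneg (by linarith) (by positivity)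
  -- The least `n` with `K ≤ ⌊α n!⌋` is `m + 1`: block `m` starts below `K`, and later blocks start
  -- at or beyond `K`.
  rcases hfind : Nat.find hex with _ | m
  · have h0 := Nat.find_spec hex
    rw [hfind] at h0
    rw [Finset.filter_eq_empty_iff.2, Finset.card_empty]
    · push_cast; positivity
    · intro k hk
      simp only [not_not]
      intro j hj
      have := hmono (Nat.zero_le j)
      have := Finset.mem_range.1 hk
      dsimp only at *
      omega
  have h1 : K ≤ ⌊α * ((m + 1) ! : ℝ)⌋₊ := by
    have := Nat.find_spec hex
    rwa [hfind] at this
  have h2 : ⌊α * (m ! : ℝ)⌋₊ < K := not_le.1 (Nat.find_min hex (by omega))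
  have hsub : (Finset.range K).filter (· ∉ digitPositions α) ⊆
      Finset.range ((m - 1) !) ∪ Finset.Ico ⌊α * (m ! : ℝ)⌋₊ (min K (m !)) := by
    intro k hk
    obtain ⟨hkK, hkF⟩ := Finset.mem_filter.1 hk
    rw [Finset.mem_range] at hkK
    simp only [digitPositions, mem_ofPred_eq, not_forall, not_not] at hkF
    obtain ⟨j, hj1, hj2⟩ := hkF
    rw [Finset.mem_union, Finset.mem_range, Finset.mem_Ico]
    rcases lt_trichotomy j m with hjm | rfl | hjm
    · exact Or.inl (hj2.trans_le (Nat.factorial_le (by omega)))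
    · exact Or.inr ⟨hj1, lt_min hkK hj2⟩
    · have := hmono (Nat.succ_le_of_lt hjm)
      dsimp only [Nat.succ_eq_add_one] at this
      omega
  have hcard : (((Finset.range K).filter (· ∉ digitPositions α)).card : ℝ) ≤
      (m - 1) ! + ((min K (m !) - ⌊α * (m ! : ℝ)⌋₊ : ℕ) : ℝ) := by
    have := (Finset.card_le_card hsub).trans (Finset.card_union_le _ _)
    rw [Finset.card_range, Nat.card_Ico] at this
    exact_mod_cast this
  have hblock : ((min K (m !) - ⌊α * (m ! : ℝ)⌋₊ : ℕ) : ℝ) ≤ (1 - α) * K + 1 := by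
    have hK0 : (0 : ℝ) ≤ (1 - α) * K := mul_nonneg (by linarith) (by positivity)
    rcases le_total (min K (m !)) ⌊α * (m ! : ℝ)⌋₊ with h | h
    · rw [Nat.sub_eq_zero_of_le h]
      push_cast; linarith
    · rw [Nat.cast_sub h]
      have h3 := Nat.lt_floor_add_one (α * (m ! : ℝ))
      have h4 : ((min K (m !) : ℕ) : ℝ) ≤ K := by exact_mod_cast min_le_left _ _
      have h5 : ((min K (m !) : ℕ) : ℝ) ≤ m ! := by exact_mod_cast min_le_right _ _
      nlinarith
  have hprev : ((m - 1) ! : ℝ) ≤ J ! + (α - t) * K := by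
    rcases le_or_gt m J with h | h
    · have h3 : ((m - 1) ! : ℝ) ≤ J ! := by
        exact_mod_cast Nat.factorial_le (show m - 1 ≤ J by omega)
      have : 0 ≤ (α - t) * K := mul_nonneg (by linarith) (by positivity)
      linarith
    · have h3 : (m ! : ℝ) = m * (m - 1) ! := by
        exact_mod_cast (Nat.mul_factorial_pred (by omega)).symm
      have h4 : α * (m ! : ℝ) < K := by
        have := Nat.lt_floor_add_one (α * (m ! : ℝ))
        have h5 : (⌊α * (m ! : ℝ)⌋₊ : ℝ) + 1 ≤ K := by exact_mod_cast h2
        linarith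
      have h5 : (J : ℝ) < m := by exact_mod_cast h
      have h6 : 1 ≤ m * (α * (α - t)) := by nlinarith
      have h7 : (0 : ℝ) < (m - 1) ! := by positivity
      have h8 : (0 : ℝ) < J ! := by positivity
      calc ((m - 1) ! : ℝ) ≤ (m * (α * (α - t))) * (m - 1) ! := le_mul_of_one_le_left h7.le h6
        _ = (α - t) * (α * (m ! : ℝ)) := by rw [h3]; ring
        _ ≤ (α - t) * K := mul_le_mul_of_nonneg_left h4.le (by linarith)
        _ ≤ _ := by linarith
  linarith

theorem hasFrostmanMeasure_digitSet {α ε : ℝ} (hα : 0 ≤ α) (hα1 : α ≤ 1) (hε : 0 < ε) :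
    HasFrostmanMeasure (digitSet α) (max 0 (α - ε)) := by
  rcases hα.eq_or_lt with rfl | hα0
  · refine hasFrostmanMeasure_range_binaryValue (C := 0) (le_max_left _ _) fun K => ?_
    rw [max_eq_left (by linarith)]
    simp
  · obtain ⟨C, hC⟩ := exists_le_countBelow_digitPositions hα0 hα1
      (max_lt hα0 (by linarith) : max 0 (α - ε) < α)
    exact hasFrostmanMeasure_range_binaryValue (le_max_left _ _) hC

theorem factorialCovered_digitSet {α : ℝ} (hα : 0 ≤ α) (hα1 : α ≤ 1) :
    FactorialCovered (digitSet α) α :=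
  .of_grid hα one_pos (fun _ hx => digitSet_abs_le_one hx) fun x hx j => by
    rw [one_mul]
    exact exists_abs_sub_le_of_mem_digitSet hα1 hx j

/-- The Frostman exponents fall short of `α` and `β` by `ε`, so the bound is obtained as `ε` tends
to `0`. -/
theorem le_dimH_digitSet_prod {α β : ℝ} (hα : 0 ≤ α) (hα1 : α ≤ 1) (hβ : 0 ≤ β) (hβ1 : β ≤ 1) :
    ENNReal.ofReal (α + β) ≤ dimH (digitSet α ×ˢ digitSet β) := by
  have hcont : Continuous fun ε : ℝ => ENNReal.ofReal (max 0 (α - ε) + max 0 (β - ε)) :=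
    ENNReal.continuous_ofReal.comp (by fun_prop)
  have hlim := (hcont.tendsto 0).mono_left (nhdsWithin_le_nhds (s := Ioi 0))
  simp only [sub_zero, max_eq_right hα, max_eq_right hβ] at hlim
  refine le_of_tendsto hlim ?_
  filter_upwards [self_mem_nhdsWithin] with ε hε
  exact ((hasFrostmanMeasure_digitSet hα hα1 hε).prod
    (hasFrostmanMeasure_digitSet hβ hβ1 hε)).le_dimH

theorem dimH_digitSet_prod₃ {α β γ : ℝ} (hα : 0 ≤ α) (hα1 : α ≤ 1) (hβ : 0 ≤ β) (hβ1 : β ≤ 1)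
    (hγ : 0 ≤ γ) (hγ1 : γ ≤ 1) :
    dimH (digitSet α ×ˢ digitSet β ×ˢ digitSet γ) = ENNReal.ofReal (α + β + γ) := by
  rw [add_assoc]
  refine le_antisymm (FactorialCovered.dimH_le (by positivity)
    ((factorialCovered_digitSet hα hα1).prod
      ((factorialCovered_digitSet hβ hβ1).prod (factorialCovered_digitSet hγ hγ1)))) ?_
  have hcont : Continuous fun ε : ℝ =>
      ENNReal.ofReal (max 0 (α - ε) + (max 0 (β - ε) + max 0 (γ - ε))) :=
    ENNReal.continuous_ofReal.comp (by fun_prop)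
  have hlim := (hcont.tendsto 0).mono_left (nhdsWithin_le_nhds (s := Ioi 0))
  simp only [sub_zero, max_eq_right hα, max_eq_right hβ, max_eq_right hγ] at hlim
  refine le_of_tendsto hlim ?_
  filter_upwards [self_mem_nhdsWithin] with ε hε
  exact ((hasFrostmanMeasure_digitSet hα hα1 hε).prod
    ((hasFrostmanMeasure_digitSet hβ hβ1 hε).prod
      (hasFrostmanMeasure_digitSet hγ hγ1 hε))).le_dimH

/-! ### Shears of products of digit sets -/

/-- The differences `y - u x` with `x` and `y` in digit sets: the projection of a product of two
digit sets along a line of slope `u`. -/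
def shearSet (α β u : ℝ) : Set ℝ := {w | ∃ x ∈ digitSet α, ∃ y ∈ digitSet β, w = y - u * x}

/-- The three alternatives for `κ` are the trivial bound on the line, the arithmetic bound from
multiplying grids, and the case `u = 0`, where the shear is `digitSet β` whatever `α` is. -/
theorem factorialCovered_shearSet {α β η κ u : ℝ} (hα : 0 ≤ α) (hα1 : α ≤ 1) (hβ : 0 ≤ β)
    (hβ1 : β ≤ 1) (hη : 0 ≤ η) (hη1 : η ≤ 1) (hu : u ∈ digitSet η)
    (hκ : κ = 1 ∨ (β ≤ κ ∧ η + α ≤ κ) ∨ (β = κ ∧ η = 0)) :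
    FactorialCovered (shearSet α β u) κ := by
  have hbdd : ∀ w ∈ shearSet α β u, |w| ≤ 4 := by
    rintro _ ⟨x, hx, y, hy, rfl⟩
    have h1 : |u * x| ≤ 1 := by
      rw [abs_mul]
      exact mul_le_one₀ (digitSet_abs_le_one hu) (abs_nonneg _) (digitSet_abs_le_one hx)
    have := abs_sub y (u * x)
    linarith [digitSet_abs_le_one hy]
  rcases hκ with rfl | ⟨hβκ, hκ⟩ | ⟨rfl, rfl⟩
  · exact .of_bounded (by norm_num) hbdd
  -- The constant `4` also bounds the grid error: `δ` from `y`, `δ` from `x`, and `2 δ` from `u`.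
  · refine .of_grid (hβ.trans hβκ) (by norm_num) hbdd ?_
    rintro _ ⟨x, hx, y, hy, rfl⟩ j
    obtain ⟨i, hi⟩ := exists_abs_sub_le_of_mem_digitSet hα1 hx j
    obtain ⟨k, hk⟩ := exists_abs_sub_le_of_mem_digitSet hβ1 hy j
    obtain ⟨p, hp⟩ := exists_abs_sub_le_of_mem_digitSet hη1 hu j
    set a := ⌊α * (j ! : ℝ)⌋₊
    set b := ⌊β * (j ! : ℝ)⌋₊
    set c := ⌊η * (j ! : ℝ)⌋₊
    set n := ⌊κ * (j ! : ℝ)⌋₊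
    set δ : ℝ := (1 / 2) ^ j ! with hδ
    have hδ1 : δ ≤ 1 := pow_le_one₀ (by norm_num) (by norm_num)
    have hbn : b ≤ n := Nat.floor_mono (by gcongr)
    have hcan : c + a ≤ n := by
      refine Nat.le_floor ?_
      push_cast
      have h1 := Nat.floor_le (show 0 ≤ α * (j ! : ℝ) by positivity)
      have h2 := Nat.floor_le (show 0 ≤ η * (j ! : ℝ) by positivity)
      have h3 : (η + α) * (j ! : ℝ) ≤ κ * j ! := by gcongr
      linarith
    -- Both `k / 2 ^ b` and `(p / 2 ^ c) * (i / 2 ^ a)` lie on the grid of mesh `2 ^ (-n)`, since `b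
    -- ≤ n` and `c + a ≤ n`.
    refine ⟨k * 2 ^ (n - b) - p * i * 2 ^ (n - (c + a)), ?_⟩
    have hgrid : (((k * 2 ^ (n - b) - p * i * 2 ^ (n - (c + a)) : ℤ) : ℝ)) / 2 ^ n =
        k / 2 ^ b - p / 2 ^ c * (i / 2 ^ a) := by
      push_cast
      obtain ⟨d, hd⟩ := Nat.exists_eq_add_of_le hbn
      obtain ⟨e, he⟩ := Nat.exists_eq_add_of_le hcan
      rw [sub_div]
      congr 1
      · rw [hd, Nat.add_sub_cancel_left, pow_add]
        field_simp
      · rw [he, Nat.add_sub_cancel_left, pow_add, pow_add]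
        field_simp
    rw [hgrid]
    have hi2 : |(i : ℝ) / 2 ^ a| ≤ 2 := by
      have := abs_sub_abs_le_abs_sub ((i : ℝ) / 2 ^ a) x
      rw [abs_sub_comm] at this
      linarith [digitSet_abs_le_one hx]
    have hsplit : y - u * x - (k / 2 ^ b - p / 2 ^ c * (i / 2 ^ a)) =
        (y - k / 2 ^ b) - u * (x - i / 2 ^ a) - (u - p / 2 ^ c) * (i / 2 ^ a) := by ring
    rw [hsplit]
    have h1 : |u * (x - i / 2 ^ a)| ≤ 1 * δ := by
      rw [abs_mul]
      exact mul_le_mul (digitSet_abs_le_one hu) hi (abs_nonneg _) zero_le_one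
    have h2 : |(u - p / 2 ^ c) * (i / 2 ^ a)| ≤ δ * 2 := by
      rw [abs_mul]
      exact mul_le_mul hp hi2 (abs_nonneg _) (by positivity)
    have h3 := abs_sub (y - k / 2 ^ b - u * (x - i / 2 ^ a)) ((u - p / 2 ^ c) * (i / 2 ^ a))
    have h4 := abs_sub (y - k / 2 ^ b) (u * (x - i / 2 ^ a))
    linarith
  · refine (factorialCovered_digitSet hβ hβ1).mono ?_
    rintro _ ⟨x, hx, y, hy, rfl⟩
    rw [eq_zero_of_mem_digitSet_zero hu]
    simpa using hy

/-! ### Planes in three-space parametrised by slopes -/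

/-- Coordinates on Euclidean three-space. -/
noncomputable def euclideanThreeEquiv : (ℝ × ℝ × ℝ) ≃L[ℝ] EuclideanSpace ℝ (Fin 3) :=
  LinearEquiv.toContinuousLinearEquiv
    { toFun := fun p => !₂[p.1, p.2.1, p.2.2]
      invFun := fun v => (v 0, v 1, v 2)
      map_add' := fun p q => by ext i; fin_cases i <;> simp
      map_smul' := fun c p => by ext i; fin_cases i <;> simp
      left_inv := fun p => by simp
      right_inv := fun v => by ext i; fin_cases i <;> simp }

theorem euclideanThreeEquiv_apply (x y z : ℝ) : euclideanThreeEquiv (x, y, z) = !₂[x, y, z] := rfl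

/-- The plane in `ℝ³` orthogonal to `(1, u, z)`. -/
noncomputable def slopePlane (p : ℝ × ℝ) : Grassmannian 2 3 :=
  ⟨(ℝ ∙ (!₂[1, p.1, p.2] : EuclideanSpace ℝ (Fin 3)))ᗮ, by
    have : Fact (Module.finrank ℝ (EuclideanSpace ℝ (Fin 3)) = 2 + 1) := ⟨by simp⟩
    refine Submodule.finrank_orthogonal_span_singleton fun h => ?_
    have := congrArg (fun v : EuclideanSpace ℝ (Fin 3) => v 0) h
    simp at this⟩

theorem orthogonalProjectionOnto_slopePlane_normal (p : ℝ × ℝ) :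
    (slopePlane p).1.orthogonalProjectionOnto (!₂[1, p.1, p.2] : EuclideanSpace ℝ (Fin 3)) = 0 :=
  Submodule.orthogonalProjectionOnto_eq_zero_iff.2
    (Submodule.le_orthogonal_orthogonal _ (Submodule.mem_span_singleton_self _))

theorem orthogonalProjectionOnto_slopePlane (p : ℝ × ℝ) (x y w : ℝ) :
    (slopePlane p).1.orthogonalProjectionOnto (euclideanThreeEquiv (x, y, w)) =
      (slopePlane p).1.orthogonalProjectionOnto
        (euclideanThreeEquiv (0, y - p.1 * x, w - p.2 * x)) := by
  have h : euclideanThreeEquiv (x, y, w) =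
      x • (!₂[1, p.1, p.2] : EuclideanSpace ℝ (Fin 3)) +
        euclideanThreeEquiv (0, y - p.1 * x, w - p.2 * x) := by
    rw [euclideanThreeEquiv_apply, euclideanThreeEquiv_apply]
    ext i
    fin_cases i <;> simp <;> ring
  rw [h, map_add, map_smul, orthogonalProjectionOnto_slopePlane_normal, smul_zero, zero_add]

/-- The normal `n'` of the second plane is killed by its projection, so its projection to the first
plane is small and `n'` is close to a multiple `c • n`. Comparing first coordinates, both `1`, shows
that `c` is close to `1`. -/
theorem dist_le_dist_slopePlane {p q : ℝ × ℝ} (hp1 : |p.1| ≤ 1) (hp2 : |p.2| ≤ 1)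
    (hq1 : |q.1| ≤ 1) (hq2 : |q.2| ≤ 1) : dist p q ≤ 4 * dist (slopePlane p) (slopePlane q) := by
  set d := dist (slopePlane p) (slopePlane q) with hd
  have hd' : d = ‖(slopePlane p).proj - (slopePlane q).proj‖ :=
    dist_eq_norm (slopePlane p).proj (slopePlane q).proj
  set n : EuclideanSpace ℝ (Fin 3) := !₂[1, p.1, p.2] with hn
  set n' : EuclideanSpace ℝ (Fin 3) := !₂[1, q.1, q.2] with hn'
  have hnorm : ‖n'‖ ≤ 2 := by
    rw [EuclideanSpace.norm_eq, Real.sqrt_le_left (by norm_num), Fin.sum_univ_three]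
    simp only [hn', Real.norm_eq_abs, sq_abs]
    simp
    have h1 := (sq_le_one_iff_abs_le_one _).2 hq1
    have h2 := (sq_le_one_iff_abs_le_one _).2 hq2
    linarith
  have hproj : (slopePlane q).proj n' = 0 := by
    have := orthogonalProjectionOnto_slopePlane_normal q
    change (((slopePlane q).1.orthogonalProjectionOnto n' : (slopePlane q).1) :
      EuclideanSpace ℝ (Fin 3)) = 0
    rw [this]; rfl
  obtain ⟨c, hc⟩ : ∃ c : ℝ, c • n = n' - (slopePlane p).proj n' := by
    have h1 : n' - (slopePlane p).proj n' ∈ (slopePlane p).1ᗮ :=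
      Submodule.sub_starProjection_mem_orthogonal _
    have h2 : (slopePlane p).1ᗮ = ℝ ∙ n := Submodule.orthogonal_orthogonal _
    rw [h2] at h1
    exact Submodule.mem_span_singleton.1 h1
  have hbound : ‖n' - c • n‖ ≤ 2 * d := by
    have h1 : n' - c • n = ((slopePlane p).proj - (slopePlane q).proj) n' := by
      rw [hc, sub_sub_cancel, sub_apply, hproj, sub_zero]
    rw [h1]
    refine (ContinuousLinearMap.le_opNorm _ _).trans ?_
    rw [← hd', mul_comm]
    exact mul_le_mul_of_nonneg_right hnorm dist_nonneg
  have hcoord : ∀ i, |n' i - c * n i| ≤ 2 * d := fun i => by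
    have := (PiLp.norm_apply_le (n' - c • n) i).trans hbound
    simpa using this
  have h0 : |1 - c| ≤ 2 * d := by simpa [hn, hn'] using hcoord 0
  have h1 : |q.1 - c * p.1| ≤ 2 * d := by simpa [hn, hn'] using hcoord 1
  have h2 : |q.2 - c * p.2| ≤ 2 * d := by simpa [hn, hn'] using hcoord 2
  have key : ∀ s t : ℝ, |s| ≤ 1 → |t - c * s| ≤ 2 * d → |s - t| ≤ 4 * d := by
    intro s t hs ht
    have h3 : s - t = (1 - c) * s - (t - c * s) := by ring
    have h4 : |(1 - c) * s| ≤ 2 * d := by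
      rw [abs_mul]
      exact (mul_le_of_le_one_right (abs_nonneg _) hs).trans h0
    rw [h3]
    have := abs_sub ((1 - c) * s) (t - c * s)
    linarith
  rw [Prod.dist_eq, Real.dist_eq, Real.dist_eq]
  exact max_le (key _ _ hp1 h1) (key _ _ hp2 h2)

theorem le_dimH_image_slopePlane {S : Set (ℝ × ℝ)} (hS : ∀ p ∈ S, |p.1| ≤ 1 ∧ |p.2| ≤ 1) :
    dimH S ≤ dimH (slopePlane '' S) := by
  have hanti : AntilipschitzWith 4 fun p : S => slopePlane p :=
    AntilipschitzWith.of_le_mul_dist fun p q => by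
      have hp := hS p p.2
      have hq := hS q q.2
      exact_mod_cast dist_le_dist_slopePlane hp.1 hp.2 hq.1 hq.2
  have h := hanti.le_dimH_image univ
  have h1 : dimH (univ : Set S) = dimH S := by
    rw [← isometry_subtype_coe.dimH_image univ, image_univ, Subtype.range_coe]
  have h2 : (fun p : S => slopePlane p) '' univ = slopePlane '' S := by
    rw [image_univ, image_eq_range]
  rwa [h1, h2] at h

theorem dimH_orthogonalProjectionOnto_slopePlane_le {α β γ κ l : ℝ} {p : ℝ × ℝ}
    (hκ : 0 ≤ κ) (hl : 0 ≤ l) (h1 : FactorialCovered (shearSet α β p.1) κ)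
    (h2 : FactorialCovered (shearSet α γ p.2) l) :
    dimH ((slopePlane p).1.orthogonalProjectionOnto ''
      (euclideanThreeEquiv '' (digitSet α ×ˢ digitSet β ×ˢ digitSet γ))) ≤
      ENNReal.ofReal (κ + l) := by
  set f : ℝ × ℝ →L[ℝ] (slopePlane p).1 := (slopePlane p).1.orthogonalProjectionOnto.comp
    ((euclideanThreeEquiv : ℝ × ℝ × ℝ →L[ℝ] EuclideanSpace ℝ (Fin 3)).comp
      (ContinuousLinearMap.inr ℝ ℝ (ℝ × ℝ))) with hf
  have hsub : (slopePlane p).1.orthogonalProjectionOnto ''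
      (euclideanThreeEquiv '' (digitSet α ×ˢ digitSet β ×ˢ digitSet γ)) ⊆
      f '' (shearSet α β p.1 ×ˢ shearSet α γ p.2) := by
    rintro _ ⟨_, ⟨⟨x, y, w⟩, ⟨hx, hy, hw⟩, rfl⟩, rfl⟩
    exact ⟨(y - p.1 * x, w - p.2 * x), ⟨⟨x, hx, y, hy, rfl⟩, ⟨x, hx, w, hw, rfl⟩⟩,
      (orthogonalProjectionOnto_slopePlane p x y w).symm⟩
  exact (dimH_mono hsub).trans ((f.lipschitz.dimH_image_le _).trans
    ((h1.prod h2).dimH_le (by positivity)))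

/-! ### Exceptional sets of products and the choice of exponents -/

theorem le_supExceptionalDim_of_digitSet {α β γ η ζ κ l s : ℝ}
    (hα : 0 ≤ α) (hα1 : α ≤ 1) (hβ : 0 ≤ β) (hβ1 : β ≤ 1) (hγ : 0 ≤ γ) (hγ1 : γ ≤ 1)
    (hη : 0 ≤ η) (hη1 : η ≤ 1) (hζ : 0 ≤ ζ) (hζ1 : ζ ≤ 1) (hκ0 : 0 ≤ κ) (hl0 : 0 ≤ l)
    (hκ : κ = 1 ∨ (β ≤ κ ∧ η + α ≤ κ) ∨ (β = κ ∧ η = 0))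
    (hl : l = 1 ∨ (γ ≤ l ∧ ζ + α ≤ l) ∨ (γ = l ∧ ζ = 0)) (hs : κ + l < s) :
    ENNReal.ofReal (η + ζ) ≤ supExceptionalDim 2 3 (α + β + γ) s := by
  set A := euclideanThreeEquiv '' (digitSet α ×ˢ digitSet β ×ˢ digitSet γ) with hA
  have hdim : dimH A = ENNReal.ofReal (α + β + γ) := by
    rw [hA, ContinuousLinearEquiv.dimH_image, dimH_digitSet_prod₃ hα hα1 hβ hβ1 hγ hγ1]
  have hsub : slopePlane '' (digitSet η ×ˢ digitSet ζ) ⊆ exceptionalSet 2 s A := by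
    rintro _ ⟨p, ⟨hp1, hp2⟩, rfl⟩
    have hlt : ENNReal.ofReal (κ + l) < ENNReal.ofReal s :=
      (ENNReal.ofReal_lt_ofReal_iff (by linarith)).2 hs
    exact (dimH_orthogonalProjectionOnto_slopePlane_le hκ0 hl0
      (factorialCovered_shearSet hα hα1 hβ hβ1 hη hη1 hp1 hκ)
      (factorialCovered_shearSet hα hα1 hγ hγ1 hζ hζ1 hp2 hl)).trans_lt hlt
  calc ENNReal.ofReal (η + ζ) ≤ dimH (digitSet η ×ˢ digitSet ζ) :=
        le_dimH_digitSet_prod hη hη1 hζ hζ1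
    _ ≤ dimH (slopePlane '' (digitSet η ×ˢ digitSet ζ)) :=
        le_dimH_image_slopePlane fun p hp =>
          ⟨digitSet_abs_le_one hp.1, digitSet_abs_le_one hp.2⟩
    _ ≤ dimH (exceptionalSet 2 s A) := dimH_mono hsub
    _ ≤ _ := le_iSup₂_of_le A hdim le_rfl

/-- The definition of the exceptional set demands dimension strictly below `s`, whereas the optimal
exponents give exactly `s`; they are used for `s' < s` and `s'` tends to `s`. -/
theorem ofReal_two_mul_sub_le_of_forall_lt {a b s : ℝ} {T : ℝ≥0∞} (hbs : b < s)
    (h : ∀ s', b < s' → s' < s → ENNReal.ofReal (2 * s' - a) ≤ T) :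
    ENNReal.ofReal (2 * s - a) ≤ T := by
  have hcont : Continuous fun s' : ℝ => ENNReal.ofReal (2 * s' - a) :=
    ENNReal.continuous_ofReal.comp (by fun_prop)
  refine le_of_tendsto ((hcont.tendsto s).mono_left (nhdsWithin_le_nhds (s := Iio s))) ?_
  filter_upwards [Ioo_mem_nhdsLT hbs] with s' hs'
  exact h s' hs'.1 hs'.2

theorem two_mul_sub_le_supExceptionalDim_of_le_one {a s : ℝ} (hs1 : s ≤ 1) (has : a / 2 < s)
    (hsa : s < a) : ENNReal.ofReal (2 * s - a) ≤ supExceptionalDim 2 3 a s := by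
  refine ofReal_two_mul_sub_le_of_forall_lt has fun s' h1 h2 => ?_
  -- Balancing `β = η + α = s'` with `α + β = a` forces these values; the third coordinate is
  -- unused.
  have := le_supExceptionalDim_of_digitSet (α := a - s') (β := s') (γ := 0) (η := 2 * s' - a)
    (ζ := 0) (κ := s') (l := 0) (s := s) (by linarith) (by linarith) (by linarith) (by linarith)
    le_rfl zero_le_one (by linarith) (by linarith) le_rfl zero_le_one (by linarith) le_rfl
    (Or.inr (Or.inl ⟨le_rfl, by linarith⟩)) (Or.inr (Or.inr ⟨rfl, rfl⟩)) (by linarith)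
  convert this using 2 <;> ring

theorem two_mul_sub_le_supExceptionalDim_of_one_lt {a s : ℝ} (ha : 1 < a) (hs2 : s ≤ 2)
    (has : (a + 1) / 2 < s) (hsa : s < a) :
    ENNReal.ofReal (2 * s - a) ≤ supExceptionalDim 2 3 a s := by
  refine ofReal_two_mul_sub_le_of_forall_lt has fun s' h1 h2 => ?_
  -- The pair `γ = ζ = 1` costs `l = 1` and gains one dimension of planes; the rest balances `β = η
  -- + α = s' - 1` with `α + β = a - 1`.
  have := le_supExceptionalDim_of_digitSet (α := a - s') (β := s' - 1) (γ := 1)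
    (η := 2 * s' - a - 1) (ζ := 1) (κ := s' - 1) (l := 1) (s := s) (by linarith) (by linarith)
    (by linarith) (by linarith) zero_le_one le_rfl (by linarith) (by linarith) zero_le_one le_rfl
    (by linarith) zero_le_one (Or.inr (Or.inl ⟨le_rfl, by linarith⟩)) (Or.inl rfl) (by linarith)
  convert this using 2 <;> ring

/-- The set lies in a coordinate plane, and a one-parameter family of planes projects it into lines.
-/
theorem one_le_supExceptionalDim_of_le_two {a s : ℝ} (ha : 0 ≤ a) (ha2 : a ≤ 2) (hs : 1 < s) :
    1 ≤ supExceptionalDim 2 3 a s := by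
  have := le_supExceptionalDim_of_digitSet (α := a / 2) (β := a / 2) (γ := 0) (η := 1)
    (ζ := 0) (κ := 1) (l := 0) (s := s) (by linarith) (by linarith) (by linarith) (by linarith)
    le_rfl zero_le_one zero_le_one le_rfl le_rfl zero_le_one zero_le_one le_rfl
    (Or.inl rfl) (Or.inr (Or.inr ⟨rfl, rfl⟩)) (by linarith)
  simpa using this

/-- The planes contain the third axis: two full coordinates collapse to one dimension and the third
keeps `a - 2`, for a total of `a - 1`. -/
theorem one_le_supExceptionalDim_of_two_le {a s : ℝ} (ha : 2 ≤ a) (ha3 : a ≤ 3) (hs : a - 1 < s) :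
    1 ≤ supExceptionalDim 2 3 a s := by
  have := le_supExceptionalDim_of_digitSet (α := 1) (β := 1) (γ := a - 2) (η := 1)
    (ζ := 0) (κ := 1) (l := a - 2) (s := s) zero_le_one le_rfl zero_le_one le_rfl (by linarith)
    (by linarith) zero_le_one le_rfl le_rfl zero_le_one zero_le_one (by linarith)
    (Or.inl rfl) (Or.inr (Or.inr ⟨rfl, rfl⟩)) (by linarith)
  rw [show (1 : ℝ) + 1 + (a - 2) = a by ring] at this
  simpa using this

theorem proposition2p4 (a s : ℝ) (hs : 0 < s) (hsa : s < min 2 a) :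
    (a ≤ 1 → ENNReal.ofReal (max 0 (2 * s - a)) ≤ supExceptionalDim 2 3 a s) ∧
    (1 < a → a ≤ 2 →
      (s ≤ a / 2 → 0 ≤ supExceptionalDim 2 3 a s) ∧
      (a / 2 < s → s ≤ 1 → ENNReal.ofReal (2 * s - a) ≤ supExceptionalDim 2 3 a s) ∧
      (1 < s → s ≤ (a + 1) / 2 → 1 ≤ supExceptionalDim 2 3 a s) ∧
      ((a + 1) / 2 < s → s < a → ENNReal.ofReal (2 * s - a) ≤ supExceptionalDim 2 3 a s)) ∧
    (2 < a → a ≤ 3 →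
      (s ≤ a - 1 → 0 ≤ supExceptionalDim 2 3 a s) ∧
      (a - 1 < s → s ≤ (a + 1) / 2 → 1 ≤ supExceptionalDim 2 3 a s) ∧
      ((a + 1) / 2 < s → s < 2 →
        ENNReal.ofReal (2 * s - a) ≤ supExceptionalDim 2 3 a s)) := by
  obtain ⟨hs2, hsa⟩ := lt_min_iff.1 hsa
  refine ⟨fun ha => ?_, fun ha ha2 => ⟨fun _ => zero_le, fun h1 h2 => ?_, fun h1 _ => ?_,
    fun h1 _ => ?_⟩, fun ha ha3 => ⟨fun _ => zero_le, fun h1 _ => ?_, fun h1 _ => ?_⟩⟩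
  · rcases le_or_gt s (a / 2) with h | h
    · rw [max_eq_left (by linarith), ENNReal.ofReal_zero]
      exact zero_le
    · rw [max_eq_right (by linarith)]
      exact two_mul_sub_le_supExceptionalDim_of_le_one (by linarith) h hsa
  · exact two_mul_sub_le_supExceptionalDim_of_le_one h2 h1 hsa
  · exact one_le_supExceptionalDim_of_le_two (by linarith) ha2 h1
  · exact two_mul_sub_le_supExceptionalDim_of_one_lt ha hs2.le h1 hsa
  · exact one_le_supExceptionalDim_of_two_le ha.le ha3 h1
  · exact two_mul_sub_le_supExceptionalDim_of_one_lt (by linarith) hs2.le h1 hsa
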